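/- **Theorem 1.1.** All compacta are compact Hausdorff spaces (possibly empty), all maps are continuous, and $\mathbf{Comp}$ is the category of compacta and maps. A map $f:X\to Y$ is *skeletal* if $f^{-1}(A)$ is nowhere dense in $X$ for every nowhere dense $A\subset Y$. A functor $F:\mathbf{Comp}\to\mathbf{Comp}$ is - *skeletal* if $Ff:FX\to FY$ is skeletal for every open surjection $f:X\to Y$ between compacta; - *monomorphic* (resp. *epimorphic*) if $Ff$ is injective (resp. surjective) whenever $f$ is; - *continuous* if it preserves limits of inverse spectra indexed by nonempty directed partially ordered sets; - *weight-preserving* if $w(FX)\le w(X)$ for every infinite compactum $X$, where the weight $w(X)$ is the least cardinality of a base of the topology of $X$. A commutative square of compacta with top map $\tilde f:\tilde X\to\tilde Y$, bottom map $f:X\to Y$ and vertical maps $p_X:\tilde X\to X$, $p_Y:\tilde Y\to Y$ is *bicommutative* if $\tilde f(p_X^{-1}(x))=p_Y^{-1}(f(x))$ for all $x\in X$. The functor $F$ *preserves finite 1-preimages* if it sends every bicommutative square with $f,\tilde f$ injective, $p_X$ bijective and $X$ finite to a bicommutative square. A *1-mec* functor is a monomorphic, epimorphic, continuous functor that preserves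 finite 1-preimages; a *1-mecw* functor is a weight-preserving 1-mec functor. For a compactum $Z$ and a natural number $n$ let $Z\oplus n$ be the topological sum of $Z$ and the discrete space $n=\{0,\dots,n-1\}$, and let $\mathit 2_Z:Z\oplus 2\to Z\oplus 1$ be the map that is the identity on $Z$ and sends both points of $2$ to the point $0$ of $1$. A compactum is *zero-dimensional* if its clopen sets form a base of its topology (so the empty space is included). 1. A 1-mec functor $F:\mathbf{Comp}\to\mathbf{Comp}$ is skeletal if and only if for every zero-dimensional compactum $Z$ the map $F\mathit 2_Z:F(Z\oplus 2)\to F(Z\oplus 1)$ is skeletal. 2. A 1-mecw functor $F:\mathbf{Comp}\to\mathbf{Comp}$ is skeletal if and only if for every zero-dimensional metrizable compactum $Z$ the map $F\mathit 2_Z:F(Z\oplus 2)\to F(Z\oplus 1)$ is skeletal. -/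

import Mathlib

open CategoryTheory CategoryTheory.Limits

universe u

namespace CompFunctor

/-- A map between topological spaces is *skeletal* if the preimage of every nowhere dense set is
nowhere dense. -/
def IsSkeletalMap {X Y : Type*} [TopologicalSpace X] [TopologicalSpace Y] (f : X → Y) : Prop :=
  ∀ A : Set Y, IsNowhereDense A → IsNowhereDense (f ⁻¹' A)

/-- The *weight* of a topological space: the smallest cardinality of a base of its topology. -/
noncomputable def weight (X : Type u) [TopologicalSpace X] : Cardinal.{u} :=
  sInf {c | ∃ B : Set (Set X), TopologicalSpace.IsTopologicalBasis B ∧ Cardinal.mk B = c}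

/-- A space is *zero-dimensional* if its clopen sets form a base of the topology. The empty space
is included. -/
def IsZeroDimensional (X : Type*) [TopologicalSpace X] : Prop :=
  TopologicalSpace.IsTopologicalBasis {s : Set X | IsClopen s}

/-- `F` sends injective maps to injective maps. -/
def IsMonomorphic (F : CompHaus.{u} ⥤ CompHaus.{u}) : Prop :=
  ∀ ⦃X Y : CompHaus.{u}⦄ (f : X ⟶ Y), Function.Injective f → Function.Injective (F.map f)

/-- `F` sends surjective maps to surjective maps. -/
def IsEpimorphic (F : CompHaus.{u} ⥤ CompHaus.{u}) : Prop :=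
  ∀ ⦃X Y : CompHaus.{u}⦄ (f : X ⟶ Y), Function.Surjective f → Function.Surjective (F.map f)

/-- `F` is *continuous*: it preserves the limits of all inverse spectra
`{X_α, p_α^β : X_β → X_α}` indexed by nonempty directed partially ordered sets. -/
def IsContinuousFunctor (F : CompHaus.{u} ⥤ CompHaus.{u}) : Prop :=
  ∀ (J : Type u) [PartialOrder J] [IsDirectedOrder J] [Nonempty J], PreservesLimitsOfShape Jᵒᵖ F

/-- The square with top `f'`, left `pX`, right `pY`, bottom `f` commutes and is *bicommutative*:
`f' (pX⁻¹ x) = pY⁻¹ (f x)` for every point `x` of `X`. -/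
def IsBicommutative {X' Y' X Y : CompHaus.{u}}
    (f' : X' ⟶ Y') (pX : X' ⟶ X) (pY : Y' ⟶ Y) (f : X ⟶ Y) : Prop :=
  f' ≫ pY = pX ≫ f ∧ ∀ x : X, f' '' (pX ⁻¹' {x}) = pY ⁻¹' {f x}

/-- `F` *preserves finite 1-preimages*: it preserves the bicommutativity of those squares whose
horizontal maps are injective, whose left map is bijective, and whose lower left corner is
finite. -/
def PreservesFiniteOnePreimages (F : CompHaus.{u} ⥤ CompHaus.{u}) : Prop :=
  ∀ ⦃X' Y' X Y : CompHaus.{u}⦄ (f' : X' ⟶ Y') (pX : X' ⟶ X) (pY : Y' ⟶ Y) (f : X ⟶ Y),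
    Finite X → Function.Injective f' → Function.Injective f → Function.Bijective pX →
    IsBicommutative f' pX pY f →
    IsBicommutative (F.map f') (F.map pX) (F.map pY) (F.map f)

/-- `F` is *weight-preserving*: `w(FX) ≤ w(X)` for each infinite compactum `X`. -/
def IsWeightPreserving (F : CompHaus.{u} ⥤ CompHaus.{u}) : Prop :=
  ∀ X : CompHaus.{u}, Infinite X → weight (F.obj X) ≤ weight X

/-- 1-mec functors: monomorphic, epimorphic, continuous, preserving finite 1-preimages. -/
structure IsOneMec (F : CompHaus.{u} ⥤ CompHaus.{u}) : Prop where
  monomorphic : IsMonomorphic F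
  epimorphic : IsEpimorphic F
  continuous : IsContinuousFunctor F
  finiteOnePreimages : PreservesFiniteOnePreimages F

/-- 1-mecw functors: weight-preserving 1-mec functors. -/
structure IsOneMecw (F : CompHaus.{u} ⥤ CompHaus.{u}) : Prop extends IsOneMec F where
  weightPreserving : IsWeightPreserving F

/-- `F` is *skeletal*: it sends every open surjection between compacta to a skeletal map. -/
def IsSkeletalFunctor (F : CompHaus.{u} ⥤ CompHaus.{u}) : Prop :=
  ∀ ⦃X Y : CompHaus.{u}⦄ (f : X ⟶ Y), IsOpenMap f → Function.Surjective f →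
    IsSkeletalMap (F.map f)

/-- The topological sum `Z ⊕ n` of a compactum `Z` and the discrete space `{0, …, n - 1}`. -/
def addFin (Z : CompHaus.{u}) (n : ℕ) : CompHaus.{u} :=
  CompHaus.of (Z ⊕ Fin n)

/-- The map `2_Z : Z ⊕ 2 → Z ⊕ 1`, the identity on `Z`, sending both points of `2` to `0`. -/
def twoMap (Z : CompHaus.{u}) : addFin Z 2 ⟶ addFin Z 1 :=
  CompHausLike.ofHom _
    (⟨Sum.map id (fun _ : Fin 2 => (0 : Fin 1)),
      continuous_id.sumMap continuous_const⟩ : C(Z ⊕ Fin 2, Z ⊕ Fin 1))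

end CompFunctor

namespace CompFunctor

/-! ### Skeletal maps -/

section Skeletal

variable {X Y Z : Type*} [TopologicalSpace X] [TopologicalSpace Y] [TopologicalSpace Z]

/-! A continuous map is skeletal exactly when the image of each nonempty open set is dense
somewhere; in this form skeletality passes to composites and descends along surjections. Each
`twoMap` is an open surjection, so necessity is immediate.

For sufficiency, precompose an open surjection with an irreducible cover of its source by a totally
disconnected compactum. This yields a map `h : X ⟶ Y` under which nonempty open sets have images
with nonempty interior. By continuity of `F` an open set of `F.obj X` contains the preimage of an
open set of `F.obj P` for a finite quotient `q : X ⟶ P`. One finds `a : T ⟶ X` meeting every fibre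
of `q`, with `a ≫ h = b ≫ c`, where `b` only glues finitely many isolated points and `c` is
irreducible. `F` makes `c` skeletal because it preserves finite 1-preimages
(`IsOneMec.isSkeletalMap_of_irreducible`), and makes `b` skeletal because `b` glues one pair at a
time, as `twoMap` does (`isSkeletalMap_of_identify_finite`). These facts combine in
`IsOneMec.isSkeletalMap_of_interior_image`.

For weight-preserving `F`, a closing-off argument (`IsOneMecw.isSkeletalMap_twoMap`) carries a
failure at a zero-dimensional `Z` to a quotient of `Z` by countably many clopen sets, which is
metrizable. -/

theorem isSkeletalMap_of_interior_closure_image {f : X → Y}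
    (h : ∀ U : Set X, IsOpen U → U.Nonempty → (interior (closure (f '' U))).Nonempty)
    (hf : Continuous f) : IsSkeletalMap f := by
  intro A hA
  by_contra hne
  have hU : (interior (closure (f ⁻¹' A))).Nonempty := Set.nonempty_iff_ne_empty.2 hne
  obtain ⟨y, hy⟩ := h _ isOpen_interior hU
  have hsub : f '' interior (closure (f ⁻¹' A)) ⊆ closure A :=
    (Set.image_mono interior_subset).trans
      ((image_closure_subset_closure_image hf).trans
        (closure_mono (Set.image_preimage_subset f A)))
  have : y ∈ interior (closure A) :=
    interior_mono (closure_minimal hsub isClosed_closure) hy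
  rw [hA] at this
  exact this

theorem IsSkeletalMap.interior_closure_image {f : X → Y} (hf : IsSkeletalMap f) {U : Set X}
    (hU : IsOpen U) (hne : U.Nonempty) : (interior (closure (f '' U))).Nonempty := by
  by_contra h
  have hA : IsNowhereDense (f '' U) := Set.not_nonempty_iff_eq_empty.1 h
  have hB : interior (closure (f ⁻¹' (f '' U))) = ∅ := hf _ hA
  obtain ⟨x, hx⟩ := hne
  have : x ∈ interior (closure (f ⁻¹' (f '' U))) :=
    interior_maximal ((Set.subset_preimage_image f U).trans subset_closure) hU hx
  rw [hB] at this
  exact this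

theorem IsSkeletalMap.comp {g : Y → Z} {f : X → Y} (hg : IsSkeletalMap g)
    (hf : IsSkeletalMap f) : IsSkeletalMap (g ∘ f) :=
  fun A hA => hf _ (hg A hA)

theorem IsSkeletalMap.of_comp {g : Y → Z} {f : X → Y} (h : IsSkeletalMap (g ∘ f))
    (hg : Continuous g) (hf : Continuous f) (hs : Function.Surjective f) : IsSkeletalMap g := by
  refine isSkeletalMap_of_interior_closure_image (fun U hU hne => ?_) hg
  have := h.interior_closure_image (hU.preimage hf) (hne.preimage hs)
  rwa [Set.image_comp, Set.image_preimage_eq U hs] at this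

theorem IsSkeletalMap.of_isOpenMap {f : X → Y} (hf : IsOpenMap f) (hc : Continuous f) :
    IsSkeletalMap f :=
  isSkeletalMap_of_interior_closure_image (fun U hU hne =>
    (hne.image f).mono (interior_maximal subset_closure (hf U hU))) hc

end Skeletal

/-! ### Morphisms of compacta -/

/-- The morphism of compacta given by a continuous function. -/
def homMk {X Y : CompHaus.{u}} (f : X → Y) (hf : Continuous f) : X ⟶ Y :=
  ConcreteCategory.ofHom (⟨f, hf⟩ : C(X, Y))

theorem hom_continuous {X Y : CompHaus.{u}} (f : X ⟶ Y) : Continuous f :=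
  (ConcreteCategory.hom f).continuous

theorem hom_isClosedMap {X Y : CompHaus.{u}} (f : X ⟶ Y) : IsClosedMap f :=
  (hom_continuous f).isClosedMap

instance compHaus_t1Space (X : CompHaus.{u}) : T1Space X :=
  have : T2Space X := X.is_hausdorff
  T2Space.t1Space

theorem isClosed_fiber {X Y : CompHaus.{u}} (f : X ⟶ Y) (y : Y) : IsClosed (f ⁻¹' {y}) :=
  (isClosed_singleton (X := Y) (x := y)).preimage (hom_continuous f)

theorem map_map_apply (F : CompHaus.{u} ⥤ CompHaus.{u}) {X Y Z : CompHaus.{u}} (f : X ⟶ Y)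
    (g : Y ⟶ Z) (x : F.obj X) : F.map g (F.map f x) = F.map (f ≫ g) x := by
  rw [F.map_comp]; rfl

theorem coe_map_comp (F : CompHaus.{u} ⥤ CompHaus.{u}) {X Y Z : CompHaus.{u}} (f : X ⟶ Y)
    (g : Y ⟶ Z) : ⇑(F.map (f ≫ g)) = F.map g ∘ F.map f := by
  rw [F.map_comp]; rfl

/-- The morphism induced by `g` on the target of a surjection `f` whose kernel is contained in
that of `g`. -/
noncomputable def descHom {X Y Z : CompHaus.{u}} (f : X ⟶ Y) (hf : Function.Surjective f)
    (g : X ⟶ Z) (h : ∀ x x', f x = f x' → g x = g x') : Y ⟶ Z :=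
  homMk (fun y => g (Function.surjInv hf y)) <| by
    refine ((hom_isClosedMap f).isQuotientMap (hom_continuous f) hf).continuous_iff.2 ?_
    convert hom_continuous g using 1
    exact funext fun x => h _ _ (Function.surjInv_eq hf (f x))

theorem descHom_apply {X Y Z : CompHaus.{u}} (f : X ⟶ Y) (hf : Function.Surjective f)
    (g : X ⟶ Z) (h : ∀ x x', f x = f x' → g x = g x') (x : X) :
    descHom f hf g h (f x) = g x :=
  h _ _ (Function.surjInv_eq hf (f x))

/-! ### Continuous functors and limits of quotients -/

section Basis

variable {J : Type u} [PartialOrder J] {X : CompHaus.{u}} {P : J → CompHaus.{u}}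

/-- The inverse system of quotients of a compactum with nested kernels. -/
noncomputable def quotientSystem
    (p : ∀ j, X ⟶ P j) (hp : ∀ j, Function.Surjective (p j))
    (hle : ∀ i j, i ≤ j → ∀ x x', p j x = p j x' → p i x = p i x') :
    Jᵒᵖ ⥤ CompHaus.{u} where
  obj j := P j.unop
  map {j i} a := descHom (p j.unop) (hp _) (p i.unop) (hle _ _ a.unop.le)
  map_id j := by
    ext y
    obtain ⟨x, rfl⟩ := hp _ y
    exact descHom_apply _ _ _ _ _
  map_comp {i j k} a b := by
    ext y
    obtain ⟨x, rfl⟩ := hp _ y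
    rw [descHom_apply, ConcreteCategory.comp_apply, descHom_apply, descHom_apply]

/-- The compactum as a cone over the system of its quotients. -/
noncomputable def quotientCone
    (p : ∀ j, X ⟶ P j) (hp : ∀ j, Function.Surjective (p j))
    (hle : ∀ i j, i ≤ j → ∀ x x', p j x = p j x' → p i x = p i x') :
    Cone (quotientSystem p hp hle) where
  pt := X
  π :=
    { app := fun j => p j.unop
      naturality := by
        intro j i a
        ext x
        exact (descHom_apply _ (hp _) _ (hle _ _ a.unop.le) x).symm }

/-- The comparison map to the limit is a bijection of compacta, hence an isomorphism: injective
because the projections separate points, surjective by compactness. -/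
theorem quotientCone_isLimit [IsDirectedOrder J] [Nonempty J]
    (p : ∀ j, X ⟶ P j) (hp : ∀ j, Function.Surjective (p j))
    (hle : ∀ i j, i ≤ j → ∀ x x', p j x = p j x' → p i x = p i x')
    (hinj : ∀ x x', (∀ j, p j x = p j x') → x = x') :
    Nonempty (IsLimit (quotientCone p hp hle)) := by
  let c := limit.cone (quotientSystem p hp hle)
  let φ : X ⟶ c.pt := limit.lift _ (quotientCone p hp hle)
  have hφ : ∀ (j : Jᵒᵖ) (x : X), c.π.app j (φ x) = p j.unop x := fun j x => by
    rw [← ConcreteCategory.comp_apply]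
    exact congrArg (fun f : X ⟶ P j.unop => f x) (limit.lift_π (quotientCone p hp hle) j)
  have hext : ∀ y y' : c.pt, (∀ j, c.π.app j y = c.π.app j y') → y = y' := fun y y' h =>
    Concrete.isLimit_ext _ (limit.isLimit (quotientSystem p hp hle)) y y' h
  have hbij : Function.Bijective φ := by
    constructor
    · intro x x' hx
      refine hinj x x' fun j => ?_
      rw [← hφ (.op j), ← hφ (.op j), hx]
    · intro y
      -- The fibres over the coordinates of `y` are nonempty, compact and directed downwards.
      have hne : (⋂ j : J, p j ⁻¹' {c.π.app (.op j) y}).Nonempty := by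
        refine IsCompact.nonempty_iInter_of_directed_nonempty_isCompact_isClosed _ ?_ ?_ ?_ ?_
        · intro i j
          obtain ⟨k, hik, hjk⟩ := exists_ge_ge i j
          have key : ∀ l, l ≤ k →
              p k ⁻¹' {c.π.app (.op k) y} ⊆ p l ⁻¹' {c.π.app (.op l) y} := by
            intro l hlk x hx
            have hw := c.w (homOfLE hlk).op
            have hx' : p k x = c.π.app (.op k) y := hx
            have : c.π.app (.op l) y =
                (quotientSystem p hp hle).map (homOfLE hlk).op (c.π.app (.op k) y) := by
              rw [← ConcreteCategory.comp_apply, hw]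
            change p l x = _
            rw [this, ← hx']
            exact (descHom_apply _ (hp k) _ (hle _ _ hlk) x).symm
          exact ⟨k, key i hik, key j hjk⟩
        · exact fun j => (Set.singleton_nonempty _).preimage (hp j)
        · exact fun j => (isClosed_fiber _ _).isCompact
        · exact fun j => isClosed_fiber _ _
      obtain ⟨x, hx⟩ := hne
      refine ⟨x, hext _ _ fun j => ?_⟩
      rw [hφ]
      exact Set.mem_iInter.1 hx j.unop
  have : IsIso φ := CompHausLike.isIso_of_bijective φ hbij
  exact ⟨IsLimit.ofPointIso (limit.isLimit (quotientSystem p hp hle)) (i := this)⟩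

/-- `F` preserves the limit, and open sets pulled back from single stages form a base of a
cofiltered limit. Continuity of `F` is used only in this form. -/
theorem IsContinuousFunctor.exists_preimage_subset [IsDirectedOrder J] [Nonempty J]
    {F : CompHaus.{u} ⥤ CompHaus.{u}} (hF : IsContinuousFunctor F)
    (p : ∀ j, X ⟶ P j) (hp : ∀ j, Function.Surjective (p j))
    (hle : ∀ i j, i ≤ j → ∀ x x', p j x = p j x' → p i x = p i x')
    (hinj : ∀ x x', (∀ j, p j x = p j x') → x = x')
    {U : Set (F.obj X)} (hU : IsOpen U) {x : F.obj X} (hx : x ∈ U) :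
    ∃ j, ∃ V : Set (F.obj (P j)), IsOpen V ∧ F.map (p j) x ∈ V ∧ F.map (p j) ⁻¹' V ⊆ U := by
  have := hF J
  obtain ⟨hlim⟩ := quotientCone_isLimit p hp hle hinj
  have hB := TopCat.isTopologicalBasis_cofiltered_limit _ _
    (isLimitOfPreserves compHausToTop (isLimitOfPreserves F hlim)) (fun _ => {V | IsOpen V})
    (fun _ => TopologicalSpace.isTopologicalBasis_opens) (fun _ => isOpen_univ)
    (fun _ _ _ h h' => IsOpen.inter h h')
    (fun i j f V hV => IsOpen.preimage
      (hom_continuous ((quotientSystem p hp hle ⋙ F).map f)) hV)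
  obtain ⟨W, ⟨j, V, hV, rfl⟩, hxW, hWU⟩ := hB.exists_subset_of_mem_open (a := x) (u := U) hx hU
  exact ⟨j.unop, V, hV, hxW, hWU⟩

end Basis

theorem IsContinuousFunctor.exists_finite_quotient {F : CompHaus.{u} ⥤ CompHaus.{u}}
    (hF : IsContinuousFunctor F) {X : CompHaus.{u}} [TotallyDisconnectedSpace X]
    {U : Set (F.obj X)} (hU : IsOpen U) {x : F.obj X} (hx : x ∈ U) :
    ∃ (P : CompHaus.{u}) (q : X ⟶ P) (V : Set (F.obj P)), Finite P ∧ Function.Surjective q ∧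
      IsOpen V ∧ F.map q x ∈ V ∧ F.map q ⁻¹' V ⊆ U := by
  -- Finer discrete quotients are smaller, so the order is reversed.
  obtain ⟨Q, V, hV, hxV, hVU⟩ := hF.exists_preimage_subset (J := (DiscreteQuotient X)ᵒᵈ)
    (P := fun Q => CompHaus.of ↥(OrderDual.ofDual Q : DiscreteQuotient X))
    (fun Q => homMk (Y := CompHaus.of ↥(OrderDual.ofDual Q : DiscreteQuotient X)) (OrderDual.ofDual Q).proj
      (DiscreteQuotient.proj_continuous _))
    (fun Q => DiscreteQuotient.proj_surjective _)
    (fun Q R hQR x x' h => by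
      have hle : OrderDual.ofDual R ≤ OrderDual.ofDual Q := hQR
      have h' : (OrderDual.ofDual R).proj x = (OrderDual.ofDual R).proj x' := h
      change (OrderDual.ofDual Q).proj x = (OrderDual.ofDual Q).proj x'
      rw [← DiscreteQuotient.ofLE_proj hle, ← DiscreteQuotient.ofLE_proj hle, h'])
    (fun x x' h => DiscreteQuotient.eq_of_forall_proj_eq fun Q => h (OrderDual.toDual Q))
    hU hx
  exact ⟨_, _, V, inferInstanceAs (Finite ↥(OrderDual.ofDual Q : DiscreteQuotient X)),
    DiscreteQuotient.proj_surjective _, hV, hxV, hVU⟩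

/-! ### Zero-dimensional compacta -/

theorem isZeroDimensional_of_totallyDisconnected (X : CompHaus.{u}) [TotallyDisconnectedSpace X] :
    IsZeroDimensional X :=
  have : T2Space X := X.is_hausdorff
  have : CompactSpace X := X.is_compact
  isTopologicalBasis_isClopen

theorem IsZeroDimensional.totallyDisconnected {X : CompHaus.{u}} (h : IsZeroDimensional X) :
    TotallyDisconnectedSpace X := by
  have : TotallySeparatedSpace X := by
    refine totallySeparatedSpace_iff_exists_isClopen.2 fun x y hxy => ?_
    obtain ⟨V, hV, hxV, hVU⟩ := TopologicalSpace.IsTopologicalBasis.exists_subset_of_mem_open h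
      (a := x) (u := {y}ᶜ) hxy isOpen_compl_singleton
    exact ⟨V, hV, hxV, fun hy => hVU hy rfl⟩
  infer_instance

/-- A closed subset of a compactum as a compactum. -/
def closedSub {X : CompHaus.{u}} (K : Set X) (hK : IsClosed K) : CompHaus.{u} :=
  have : CompactSpace X := X.is_compact
  have : T2Space X := X.is_hausdorff
  have : CompactSpace K := isCompact_iff_compactSpace.1 hK.isCompact
  CompHaus.of K

/-- The inclusion of a closed subset of a compactum. -/
def closedSubι {X : CompHaus.{u}} (K : Set X) (hK : IsClosed K) : closedSub K hK ⟶ X :=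
  homMk (X := closedSub K hK) (fun x : K => x.1) continuous_subtype_val

instance closedSub_totallyDisconnected {X : CompHaus.{u}} [TotallyDisconnectedSpace X] (K : Set X)
    (hK : IsClosed K) : TotallyDisconnectedSpace (closedSub K hK) :=
  inferInstanceAs (TotallyDisconnectedSpace K)

/-! ### Irreducible maps -/

/-- A surjection is *irreducible* if no proper closed subset is mapped onto the codomain. -/
def IsIrreducibleMap {X Y : Type*} [TopologicalSpace X] (g : X → Y) : Prop :=
  Function.Surjective g ∧ ∀ C : Set X, IsClosed C → g '' C = Set.univ → C = Set.univ

theorem IsIrreducibleMap.exists_preimage_subset {X Y : Type*} [TopologicalSpace X]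
    [TopologicalSpace Y] {g : X → Y} (hg : IsIrreducibleMap g) (hc : IsClosedMap g) {O : Set X}
    (hO : IsOpen O) (hne : O.Nonempty) : ∃ V : Set Y, IsOpen V ∧ V.Nonempty ∧ g ⁻¹' V ⊆ O := by
  refine ⟨(g '' Oᶜ)ᶜ, (hc _ hO.isClosed_compl).isOpen_compl, ?_, fun x hx => ?_⟩
  · rw [Set.nonempty_compl]
    intro h
    have := hg.2 _ hO.isClosed_compl h
    rw [Set.compl_univ_iff] at this
    exact hne.ne_empty this
  · by_contra hxO
    exact hx ⟨x, hxO, rfl⟩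

/-- By Zorn's lemma there is a minimal closed set that still maps onto `Y`. -/
theorem exists_closed_irreducible {X Y : CompHaus.{u}} (f : X ⟶ Y) (hf : Function.Surjective f) :
    ∃ (K : Set X) (hK : IsClosed K), IsIrreducibleMap (closedSubι K hK ≫ f) := by
  have : CompactSpace X := X.is_compact
  have : T2Space X := X.is_hausdorff
  obtain ⟨E, hE, himg, hmin⟩ := exists_compact_surjective_zorn_subset (hom_continuous f) hf
  have hEc : IsClosed E := (isCompact_iff_compactSpace.2 hE).isClosed
  refine ⟨E, hEc, ?_, fun C hC hCu => ?_⟩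
  · intro y
    obtain ⟨x, hx, hxy⟩ : y ∈ f '' E := himg ▸ Set.mem_univ y
    exact ⟨⟨x, hx⟩, hxy⟩
  · by_contra hne
    exact hmin C hne hC hCu

/-- Every compactum is an irreducible image of a totally disconnected compactum. -/
theorem exists_irreducible_cover (X : CompHaus.{u}) :
    ∃ (X' : CompHaus.{u}) (p : X' ⟶ X), TotallyDisconnectedSpace X' ∧ IsIrreducibleMap p := by
  have : CompactSpace X := X.is_compact
  have : T2Space X := X.is_hausdorff
  -- Each ultrafilter goes to its limit; principal ultrafilters already give surjectivity.
  let p : CompHaus.of (Ultrafilter X) ⟶ X :=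
    homMk (X := CompHaus.of (Ultrafilter X)) (Ultrafilter.extend (id : X → X))
      (continuous_ultrafilter_extend _)
  have hp : Function.Surjective p := fun x =>
    ⟨(pure x : Ultrafilter X), congrFun (ultrafilter_extend_extends (id : X → X)) x⟩
  have : TotallyDisconnectedSpace (CompHaus.of (Ultrafilter X)) :=
    inferInstanceAs (TotallyDisconnectedSpace (Ultrafilter X))
  obtain ⟨K, hK, h⟩ := exists_closed_irreducible p hp
  exact ⟨_, _, inferInstance, h⟩

theorem discreteTopology_of_finite (P : CompHaus.{u}) [Finite P] : DiscreteTopology P :=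
  inferInstance

/-- Factor `g` through the image `M` of `(g, q)` in `Y × P`. Irreducibility puts a whole fibre of
`g` inside each piece of `q`, so `g₁ : M ⟶ Y` is one-to-one over finitely many points indexed by
`P`. Preservation of finite 1-preimages then controls a fibre of `F.map g₁`. -/
theorem IsOneMec.isSkeletalMap_of_irreducible {F : CompHaus.{u} ⥤ CompHaus.{u}}
    (hF : IsOneMec F) {X Y : CompHaus.{u}} [TotallyDisconnectedSpace X] (g : X ⟶ Y)
    (hg : IsIrreducibleMap g) : IsSkeletalMap (F.map g) := by
  refine isSkeletalMap_of_interior_closure_image (fun U hU hne => ?_) (hom_continuous _)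
  obtain ⟨x, hx⟩ := hne
  obtain ⟨P, q, V, hP, hq, hV, hxV, hVU⟩ := hF.continuous.exists_finite_quotient hU hx
  have := discreteTopology_of_finite P
  let gq : X ⟶ CompHaus.of (Y × P) :=
    homMk (Y := CompHaus.of (Y × P)) (fun x => (g x, q x))
      ((hom_continuous g).prodMk (hom_continuous q))
  have hM : IsClosed (Set.range gq) := (isCompact_range (hom_continuous gq)).isClosed
  let M := closedSub (Set.range gq) hM
  let r : X ⟶ M := homMk (Y := M) (fun x => ⟨gq x, x, rfl⟩)
    ((hom_continuous gq).subtype_mk _)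
  have hr : Function.Surjective r := by
    rintro ⟨_, x, rfl⟩
    exact ⟨x, rfl⟩
  let g₁ : M ⟶ Y := homMk (X := M) (fun m : Set.range gq => m.1.1)
    (continuous_fst.comp continuous_subtype_val)
  let q₁ : M ⟶ P := homMk (X := M) (fun m : Set.range gq => m.1.2)
    (continuous_snd.comp continuous_subtype_val)
  have hrg : r ≫ g₁ = g := rfl
  have hrq : r ≫ q₁ = q := rfl
  have hg₁ : Function.Surjective g₁ := fun y => by
    obtain ⟨x, rfl⟩ := hg.1 y
    exact ⟨r x, rfl⟩
  have hpt : ∀ i : P, ∃ x : X, q x = i ∧ ∀ x', g x' = g x → q x' = i := fun i => by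
    obtain ⟨W, -, ⟨y, hy⟩, hWO⟩ := hg.exists_preimage_subset (hom_isClosedMap g)
      (O := q ⁻¹' {i}) ((isOpen_discrete _).preimage (hom_continuous q))
      ((Set.singleton_nonempty i).preimage hq)
    obtain ⟨x, rfl⟩ := hg.1 y
    exact ⟨x, hWO hy, fun x' hx' => hWO (show g x' ∈ W from hx' ▸ hy)⟩
  choose s hsq hsg using hpt
  let sM : P ⟶ M := homMk (fun i => r (s i)) continuous_of_discreteTopology
  let f : P ⟶ Y := homMk (fun i => g (s i)) continuous_of_discreteTopology
  have hf : Function.Injective f := fun i j hij => by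
    rw [← hsq i]; exact hsg j _ hij
  have hsM : Function.Injective sM := fun i j hij =>
    hf (congrArg g₁ hij)
  have hsM' : ∀ i, sM '' ((𝟙 P : P ⟶ P) ⁻¹' {i}) = g₁ ⁻¹' {f i} := fun i => by
    ext m
    constructor
    · rintro ⟨j, hj, rfl⟩
      obtain rfl : j = i := hj
      rfl
    · intro hm
      obtain ⟨x, rfl⟩ := hr m
      have hgx : g x = g (s i) := hm
      refine ⟨i, rfl, Subtype.ext (Prod.ext hgx.symm ?_)⟩
      exact (hsq i).trans (hsg i x hgx).symm
  -- The fibre of `F.map g₁` over `F.map f (F.map q x)` is thus the single point `F.map sM (F.map q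
  -- x)`, which `F.map q₁` sends into `V`.
  have hbi := (hF.finiteOnePreimages sM (𝟙 P) g₁ f hP hsM hf Function.bijective_id
    ⟨rfl, hsM'⟩).2 (F.map q x)
  -- The points whose whole `F.map g₁`-fibre lies over `V`.
  have hN : IsOpen (F.map g₁ '' (F.map q₁ ⁻¹' V)ᶜ)ᶜ :=
    (hom_isClosedMap _ _ (hV.preimage (hom_continuous _)).isClosed_compl).isOpen_compl
  refine ⟨F.map f (F.map q x), interior_maximal (subset_trans ?_ subset_closure) hN ?_⟩
  · intro y hy
    obtain ⟨m, rfl⟩ := hF.epimorphic g₁ hg₁ y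
    obtain ⟨z, rfl⟩ := hF.epimorphic r hr m
    have hz : F.map r z ∈ F.map q₁ ⁻¹' V := by
      by_contra h
      exact hy ⟨_, h, rfl⟩
    refine ⟨z, hVU ?_, by rw [map_map_apply, hrg]⟩
    rwa [Set.mem_preimage, map_map_apply, hrq] at hz
  · rintro ⟨m, hm, hmf⟩
    have hm' : m ∈ F.map g₁ ⁻¹' {F.map f (F.map q x)} := hmf
    rw [← hbi] at hm'
    obtain ⟨a, ha, rfl⟩ := hm'
    refine hm ?_
    have ha' : a = F.map q x := by
      rw [F.map_id] at ha
      exact ha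
    have hid : sM ≫ q₁ = 𝟙 P := by
      ext i
      exact hsq i
    rw [Set.mem_preimage, map_map_apply, hid, F.map_id, ha']
    exact hxV

/-! ### Identifying isolated points -/

theorem isSkeletalMap_of_bijective (F : CompHaus.{u} ⥤ CompHaus.{u}) {X Y : CompHaus.{u}} (f : X ⟶ Y) (hf : Function.Bijective f) :
    IsSkeletalMap (F.map f) := by
  have : IsIso f := CompHausLike.isIso_of_bijective f hf
  exact IsSkeletalMap.of_isOpenMap
    (CompHausLike.homeoOfIso (asIso (F.map f))).isOpenMap (hom_continuous _)

/-- With `Z` the complement of `{i, j}`, the map `g` becomes `twoMap Z` after precomposing with `φ :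
Z ⊕ 2 → T`. Only surjectivity of `φ` is needed, so `i = j` is allowed. -/
theorem isSkeletalMap_of_identify_pair
    {F : CompHaus.{u} ⥤ CompHaus.{u}} (hF : IsEpimorphic F)
    (h2 : ∀ Z : CompHaus.{u}, IsZeroDimensional Z → IsSkeletalMap (F.map (twoMap Z)))
    {T S : CompHaus.{u}} [TotallyDisconnectedSpace T]
    (g : T ⟶ S) (hg : Function.Surjective g) {i j : T} (hi : IsOpen {i})
    (hj : IsOpen {j}) (hgij : g i = g j)
    (hinj : ∀ x x', g x = g x' → x = x' ∨ ((x = i ∨ x = j) ∧ (x' = i ∨ x' = j))) :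
    IsSkeletalMap (F.map g) := by
  have hK : IsClosed ({i} ∪ {j} : Set T)ᶜ := (hi.union hj).isClosed_compl
  let Z := closedSub _ hK
  let φ : addFin Z 2 ⟶ T := homMk (X := addFin Z 2)
    (Sum.elim (fun z : (({i} ∪ {j} : Set T)ᶜ : Set T) => z.1) ![i, j])
    (continuous_subtype_val.sumElim continuous_of_discreteTopology)
  let ψ : addFin Z 1 ⟶ S := homMk (X := addFin Z 1)
    (Sum.elim (fun z : (({i} ∪ {j} : Set T)ᶜ : Set T) => g z.1) (fun _ : Fin 1 => g i))
    (((hom_continuous g).comp continuous_subtype_val).sumElim continuous_const)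
  have hcomp : φ ≫ g = twoMap Z ≫ ψ := by
    ext x
    rcases x with z | k
    · rfl
    · fin_cases k
      · rfl
      · exact hgij.symm
  have hφ : Function.Surjective φ := by
    intro x
    by_cases hxi : x = i
    · exact ⟨.inr 0, hxi.symm⟩
    by_cases hxj : x = j
    · exact ⟨.inr 1, hxj.symm⟩
    · exact ⟨.inl ⟨x, by simp [hxi, hxj]⟩, rfl⟩
  have hψ : Function.Bijective ψ := by
    constructor
    · rintro (⟨z, hz⟩ | k) (⟨z', hz'⟩ | k') h
      · have h' : g z = g z' := h
        rcases hinj _ _ h' with h'' | ⟨h'', -⟩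
        · subst h''; rfl
        · exact absurd h'' hz
      · have h' : g z = g i := h
        rcases hinj _ _ h' with h'' | ⟨h'', -⟩
        · exact absurd (Or.inl h'') hz
        · exact absurd h'' hz
      · have h' : g i = g z' := h
        rcases hinj _ _ h' with h'' | ⟨-, h''⟩
        · exact absurd (Or.inl h''.symm) hz'
        · exact absurd h'' hz'
      · exact congrArg Sum.inr (Subsingleton.elim k k')
    · intro y
      obtain ⟨x, rfl⟩ := hg y
      obtain ⟨w, rfl⟩ := hφ x
      exact ⟨twoMap Z w, (congrArg (fun f : addFin Z 2 ⟶ S => f w) hcomp).symm⟩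
  have hsk : IsSkeletalMap (F.map (φ ≫ g)) := by
    rw [hcomp, coe_map_comp]
    exact (isSkeletalMap_of_bijective F ψ hψ).comp
      (h2 Z (isZeroDimensional_of_totallyDisconnected Z))
  rw [coe_map_comp] at hsk
  exact hsk.of_comp (hom_continuous _) (hom_continuous _) (hF φ hφ)

/-- Induction on the number of isolated points: a glued pair `i`, `j` is merged by moving `j` to
`i`, and the rest of `g` lives on the complement of `j`. -/
theorem isSkeletalMap_of_identify_finite
    {F : CompHaus.{u} ⥤ CompHaus.{u}} (hF : IsEpimorphic F)
    (h2 : ∀ Z : CompHaus.{u}, IsZeroDimensional Z → IsSkeletalMap (F.map (twoMap Z)))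
    (n : ℕ) : ∀ {T S : CompHaus.{u}}
    [TotallyDisconnectedSpace T] (g : T ⟶ S) (_ : Function.Surjective g) (A : Set T)
    (_ : A.Finite) (_ : A.ncard = n) (_ : ∀ a ∈ A, IsOpen {a})
    (_ : ∀ x x', g x = g x' → x = x' ∨ (x ∈ A ∧ x' ∈ A)), IsSkeletalMap (F.map g) := by
  induction n with
  | zero =>
    intro T S _ g hg A hA hn hAo hinj
    rw [Set.ncard_eq_zero hA] at hn
    subst hn
    exact isSkeletalMap_of_bijective F g
      ⟨fun x x' h => (hinj x x' h).resolve_right fun h => h.1, hg⟩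
  | succ n ih =>
    intro T S _ g hg A hA hn hAo hinj
    by_cases hgi : Function.Injective g
    · exact isSkeletalMap_of_bijective F g ⟨hgi, hg⟩
    obtain ⟨i, j, hgij, hij⟩ : ∃ i j, g i = g j ∧ i ≠ j := by
      simpa [Function.Injective] using hgi
    obtain ⟨hiA, hjA⟩ := (hinj i j hgij).resolve_left hij
    have hK : IsClosed ({j} : Set T)ᶜ := (hAo j hjA).isClosed_compl
    let T' := closedSub _ hK
    classical
    let r : T ⟶ T' := homMk (Y := T')
      (fun x => (⟨if x = j then i else x, by split_ifs with h <;> simp [*]⟩ : ({j}ᶜ : Set T)))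
      (by
        refine Continuous.subtype_mk ?_ _
        refine continuous_const.if (fun a ha => ?_) continuous_id
        have hcl : IsClopen {a : T | a = j} := ⟨isClosed_singleton, hAo j hjA⟩
        rw [hcl.frontier_eq] at ha
        exact ha.elim)
    let g' : T' ⟶ S := closedSubι _ hK ≫ g
    have hr : ∀ x, (r x).1 = if x = j then i else x := fun x => rfl
    have hcomp : r ≫ g' = g := by
      ext x
      change g (if x = j then i else x) = g x
      split_ifs with h
      · rw [h, hgij]
      · rfl
    have hrs : Function.Surjective r := by
      rintro ⟨x, hx⟩
      refine ⟨x, Subtype.ext ?_⟩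
      exact if_neg hx
    rw [← hcomp, coe_map_comp]
    refine IsSkeletalMap.comp ?_ (isSkeletalMap_of_identify_pair hF h2 r hrs (hAo i hiA)
      (hAo j hjA) (Subtype.ext (by rw [hr, hr]; simp)) ?_)
    · refine ih g' ?_ (Subtype.val ⁻¹' A) (hA.preimage Subtype.val_injective.injOn) ?_ ?_ ?_
      · intro y
        obtain ⟨x, rfl⟩ := hg y
        exact ⟨r x, congrArg (fun f : T ⟶ S => f x) hcomp⟩
      · have h1 : (Subtype.val ⁻¹' A : Set ({j}ᶜ : Set T)).ncard = (A \ {j}).ncard := by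
          rw [← Set.ncard_image_of_injective _ Subtype.val_injective,
            Subtype.image_preimage_coe]
          congr 1
          ext x
          simp [and_comm]
        have h2 := Set.ncard_sdiff_singleton_of_mem hjA
        exact h1.trans (by omega)
      · intro a ha
        have := (hAo a.1 ha).preimage (continuous_subtype_val (p := (· ∈ ({j}ᶜ : Set T))))
        have e : ({a} : Set ({j}ᶜ : Set T)) = Subtype.val ⁻¹' {a.1} :=
          Set.ext fun b => Subtype.ext_iff
        exact e ▸ this
      · intro x x' h
        rcases hinj _ _ h with h | h
        · exact .inl (Subtype.ext h)
        · exact .inr h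
    · intro x x' h
      have h' := congrArg Subtype.val h
      rw [hr, hr] at h'
      split_ifs at h' with h1 h2 h2
      · exact .inl (h1.trans h2.symm)
      · exact .inr ⟨.inr h1, .inl h'.symm⟩
      · exact .inr ⟨.inl h', .inr h2⟩
      · exact .inl h'

/-! ### Zero-dimensional sources -/

/-- Points can be chosen in finitely many nonempty open sets so that only isolated points are
chosen repeatedly. -/
theorem exists_points_distinct_or_isolated {P Y : Type*} [Finite P] [TopologicalSpace Y]
    [T1Space Y] (W : P → Set Y) (hW : ∀ i, IsOpen (W i)) (hne : ∀ i, (W i).Nonempty) :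
    ∃ y : P → Y, (∀ i, y i ∈ W i) ∧ ∀ i j, i ≠ j → y i = y j → IsOpen {y i} := by
  classical
  have := Fintype.ofFinite P
  suffices h : ∀ s : Finset P, ∃ y : P → Y, (∀ i, y i ∈ W i) ∧
      ∀ i ∈ s, ∀ j ∈ s, i ≠ j → y i = y j → IsOpen {y i} by
    obtain ⟨y, hy, h⟩ := h Finset.univ
    exact ⟨y, hy, fun i j => h i (Finset.mem_univ i) j (Finset.mem_univ j)⟩
  intro s
  induction s using Finset.induction_on with
  | empty =>
    choose y hy using hne
    exact ⟨y, hy, by simp⟩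
  | insert k s hk ih =>
    obtain ⟨y, hy, hiso⟩ := ih
    -- An isolated point of `W k` is taken if there is one. Otherwise `W k` is infinite, since a
    -- finite open set in a T1 space consists of isolated points, and earlier choices can be
    -- avoided.
    have key : ∃ v ∈ W k, IsOpen {v} ∨ ∀ i ∈ s, y i ≠ v := by
      by_cases hv : ∃ v ∈ W k, IsOpen {v}
      · obtain ⟨v, hv, hvo⟩ := hv
        exact ⟨v, hv, .inl hvo⟩
      · have hinf : (W k).Infinite := by
          intro hfin
          obtain ⟨v, hvW⟩ := hne k
          refine hv ⟨v, hvW, ?_⟩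
          have h1 : ({v} : Set Y) = W k ∩ (W k \ {v})ᶜ := by
            ext w
            simp only [Set.mem_singleton_iff, Set.mem_inter_iff, Set.mem_compl_iff, Set.mem_sdiff]
            constructor
            · rintro rfl; exact ⟨hvW, by simp⟩
            · rintro ⟨h, h'⟩; by_contra hne; exact h' ⟨h, hne⟩
          rw [h1]
          exact (hW k).inter (hfin.subset Set.sdiff_subset).isClosed.isOpen_compl
        obtain ⟨v, hvW, hvs⟩ := hinf.exists_notMem_finset (s.image y)
        exact ⟨v, hvW, .inr fun i hi h => hvs (Finset.mem_image.2 ⟨i, hi, h⟩)⟩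
    obtain ⟨v, hvW, hv⟩ := key
    have hupd : ∀ i ∈ s, Function.update y k v i = y i := fun i hi =>
      Function.update_of_ne (fun h : i = k => hk (h ▸ hi)) _ _
    refine ⟨Function.update y k v, fun i => ?_, fun i hi j hj hij h => ?_⟩
    · by_cases hik : i = k
      · subst hik; simpa using hvW
      · simpa [Function.update_of_ne hik] using hy i
    · rcases Finset.mem_insert.1 hi with rfl | hi' <;> rcases Finset.mem_insert.1 hj with rfl | hj'
      · exact absurd rfl hij
      · rw [Function.update_self] at h ⊢
        rw [hupd j hj'] at h
        exact hv.resolve_right fun hs => hs j hj' h.symm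
      · rw [h, Function.update_self]
        rw [Function.update_self, hupd i hi'] at h
        exact hv.resolve_right fun hs => hs i hi' h
      · rw [hupd i hi', hupd j hj'] at h
        rw [hupd i hi']
        exact hiso i hi' j hj' hij h

theorem IsOneMec.isSkeletalMap_of_interior_image {F : CompHaus.{u} ⥤ CompHaus.{u}}
    (hF : IsOneMec F)
    (h2 : ∀ Z : CompHaus.{u}, IsZeroDimensional Z → IsSkeletalMap (F.map (twoMap Z)))
    {X Y : CompHaus.{u}} [TotallyDisconnectedSpace X] (h : X ⟶ Y) (hs : Function.Surjective h)
    (hint : ∀ O : Set X, IsOpen O → O.Nonempty → (interior (h '' O)).Nonempty) :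
    IsSkeletalMap (F.map h) := by
  classical
  have : T2Space Y := Y.is_hausdorff
  refine isSkeletalMap_of_interior_closure_image (fun U hU hne => ?_) (hom_continuous _)
  obtain ⟨x₀, hx₀⟩ := hne
  obtain ⟨P, q, V, hP, hq, hV, hxV, hVU⟩ := hF.continuous.exists_finite_quotient hU hx₀
  have := discreteTopology_of_finite P
  have hqo : ∀ i : P, IsClopen (q ⁻¹' {i}) := fun i =>
    (isClopen_discrete _).preimage (hom_continuous q)
  obtain ⟨y, hyW, hyiso⟩ := exists_points_distinct_or_isolated
    (fun i : P => interior (h '' (q ⁻¹' {i}))) (fun _ => isOpen_interior)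
    (fun i => hint _ (hqo i).isOpen ((Set.singleton_nonempty i).preimage hq))
  -- Repetitions occur only among indices in `I`; their points form the finite clopen set `E`,
  -- treated separately.
  let I : Set P := {i | IsOpen {y i}}
  have hyI : ∀ i j, i ∉ I → y i = y j → i = j := fun i j hi hij => by
    by_contra hne
    exact hi (hyiso i j hne hij)
  let E : Set Y := y '' I
  have hEfin : E.Finite := (Set.toFinite I).image y
  have hEc : IsClosed E := hEfin.isClosed
  have hEo : IsOpen E := by
    rw [← Set.biUnion_of_singleton E]
    refine isOpen_biUnion ?_
    rintro _ ⟨i, hi, rfl⟩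
    exact hi
  have hyE : ∀ i, i ∉ I → y i ∉ E := by
    rintro i hi ⟨j, hj, hji⟩
    exact hi ((hyI i j hi hji.symm) ▸ hj)
  obtain ⟨N, hN, hNd⟩ := (Set.finite_range y).t2_separation
  let N' : P → Set Y := fun i => N (y i) ∩ interior (h '' (q ⁻¹' {i}))
  have hN'o : ∀ i, IsOpen (N' i) := fun i => (hN _).2.inter isOpen_interior
  have hyN' : ∀ i, y i ∈ N' i := fun i => ⟨(hN _).1, hyW i⟩
  have hN'd : ∀ i j z, i ∉ I → z ∈ N' i → z ∈ N' j → i = j := fun i j z hi hzi hzj => by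
    by_contra hne
    exact (hNd (Set.mem_range_self i) (Set.mem_range_self j) fun h => hne (hyI i j hi h)).le_bot
      ⟨hzi.1, hzj.1⟩
  -- a closed set over `Eᶜ` whose points over `N' i` lie in the `i`-th clopen piece
  let X₁ : Set X := h ⁻¹' Eᶜ ∩ ⋂ i ∈ Iᶜ, (h ⁻¹' (N' i)ᶜ ∪ q ⁻¹' {i})
  have hX₁ : IsClosed X₁ := by
    refine (hEo.isClosed_compl.preimage (hom_continuous h)).inter ?_
    exact isClosed_biInter fun i _ =>
      ((hN'o i).isClosed_compl.preimage (hom_continuous h)).union (hqo i).isClosed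
  let Z := closedSub Eᶜ hEo.isClosed_compl
  let h₁ : closedSub X₁ hX₁ ⟶ Z := homMk (X := closedSub X₁ hX₁) (Y := Z)
    (fun x : X₁ => (⟨h x.1, x.2.1⟩ : (Eᶜ : Set Y)))
    (((hom_continuous h).comp continuous_subtype_val).subtype_mk _)
  have hh₁ : Function.Surjective h₁ := by
    rintro ⟨z, hz⟩
    obtain ⟨x, hxz, hx⟩ : ∃ x, h x = z ∧ ∀ i ∉ I, z ∈ N' i → q x = i := by
      by_cases hzi : ∃ i ∉ I, z ∈ N' i
      · obtain ⟨i, hi, hzi⟩ := hzi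
        obtain ⟨x, hxi, hxz⟩ := interior_subset hzi.2
        exact ⟨x, hxz, fun j _ hzj => hxi.trans (hN'd i j z hi hzi hzj)⟩
      · obtain ⟨x, hx⟩ := hs z
        exact ⟨x, hx, fun i hi hz => absurd ⟨i, hi, hz⟩ hzi⟩
    subst hxz
    refine ⟨⟨x, hz, Set.mem_iInter₂.2 fun i hi => ?_⟩, rfl⟩
    by_cases hxi : h x ∈ N' i
    · exact .inr (hx i hi hxi)
    · exact .inl hxi
  -- Shrinking to `K` keeps the constraint defining `X₁`, so a point of `K` over `y i` with `i ∉ I`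
  -- still lies in the `i`-th piece.
  obtain ⟨K, hK, hirr⟩ := exists_closed_irreducible h₁ hh₁
  let K' := closedSub K hK
  let g : K' ⟶ Z := closedSubι K hK ≫ h₁
  have hEcomp : CompactSpace E := isCompact_iff_compactSpace.1 hEc.isCompact
  -- `T` has one isolated point per index in `I`, while `S` has one per point of `E`; the map `b`
  -- glues indices sharing the same `y i`.
  let T := CompHaus.of (K' ⊕ I)
  let S := CompHaus.of (K' ⊕ E)
  let b : T ⟶ S := homMk (X := T) (Y := S)
    (Sum.map id (fun i : I => (⟨y i, i, i.2, rfl⟩ : E)))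
    (continuous_id.sumMap continuous_of_discreteTopology)
  let c : S ⟶ Y := homMk (X := S)
    (Sum.elim (fun k : K' => (show (Eᶜ : Set Y) from g k).1) (fun e : E => e.1))
    ((continuous_subtype_val.comp (hom_continuous g)).sumElim continuous_subtype_val)
  have hpt : ∀ i : I, ∃ x, q x = i ∧ h x = y i := fun i => by
    obtain ⟨x, hx, hxy⟩ := interior_subset (hyW i)
    exact ⟨x, hx, hxy⟩
  choose xi hxiq hxih using hpt
  let a : T ⟶ X := homMk (X := T)
    (Sum.elim (fun k : K' => (closedSubι K hK ≫ closedSubι X₁ hX₁) k) xi)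
    ((hom_continuous (closedSubι K hK ≫ closedSubι X₁ hX₁)).sumElim
      continuous_of_discreteTopology)
  have hcomm : a ≫ h = b ≫ c := by
    ext t
    rcases t with k | i
    · rfl
    · exact hxih i
  have hsec : ∀ i : P, ∃ t : T, q (a t) = i := fun i => by
    by_cases hi : i ∈ I
    · exact ⟨.inr ⟨i, hi⟩, hxiq ⟨i, hi⟩⟩
    · obtain ⟨k, hk⟩ := hirr.1 (⟨y i, hyE i hi⟩ : (Eᶜ : Set Y))
      refine ⟨.inl k, ?_⟩
      have hk' : h k.1.1 = y i := congrArg Subtype.val hk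
      refine (Set.mem_iInter₂.1 k.1.2.2 i hi).resolve_left fun hn => hn ?_
      change h k.1.1 ∈ N' i
      rw [hk']
      exact hyN' i
  choose s hsq using hsec
  let σ : P ⟶ T := homMk s continuous_of_discreteTopology
  have hσ : σ ≫ a ≫ q = 𝟙 P := by
    ext i
    exact hsq i
  have hc : IsIrreducibleMap c := by
    constructor
    · intro z
      by_cases hz : z ∈ E
      · exact ⟨.inr ⟨z, hz⟩, rfl⟩
      · obtain ⟨k, hk⟩ := hirr.1 (⟨z, hz⟩ : (Eᶜ : Set Y))
        exact ⟨.inl k, congrArg Subtype.val hk⟩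
    · intro C hC hCu
      have h1 : (Sum.inl ⁻¹' C : Set K') = Set.univ := by
        refine hirr.2 _ (hC.preimage continuous_inl) (Set.eq_univ_of_forall ?_)
        rintro ⟨z, hz⟩
        obtain ⟨w, hw, hwz⟩ : z ∈ c '' C := hCu ▸ Set.mem_univ z
        rcases w with k | e
        · exact ⟨k, hw, Subtype.ext hwz⟩
        · have hez : e.1 = z := hwz
          exact absurd (hez ▸ e.2) hz
      refine Set.eq_univ_of_forall ?_
      rintro (k | e)
      · exact (h1 ▸ Set.mem_univ k : k ∈ (Sum.inl ⁻¹' C : Set K'))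
      · obtain ⟨w, hw, hwz⟩ : e.1 ∈ c '' C := hCu ▸ Set.mem_univ e.1
        rcases w with k | e'
        · have hke : (show (Eᶜ : Set Y) from g k).1 = e.1 := hwz
          exact absurd (hke ▸ e.2) (show (Eᶜ : Set Y) from g k).2
        · have : e' = e := Subtype.ext hwz
          exact this ▸ hw
  have hTD : TotallyDisconnectedSpace T :=
    inferInstanceAs (TotallyDisconnectedSpace (K' ⊕ I))
  have hEf : Finite E := hEfin
  have hEd : DiscreteTopology E := inferInstance
  have hEt : TotallyDisconnectedSpace E :=
    @TotallySeparatedSpace.totallyDisconnectedSpace E _ (TotallySeparatedSpace.of_discrete E)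
  have hSD : TotallyDisconnectedSpace S :=
    inferInstanceAs (TotallyDisconnectedSpace (K' ⊕ E))
  have hb : IsSkeletalMap (F.map b) := by
    refine isSkeletalMap_of_identify_finite hF.epimorphic h2 _ b ?_ (Set.range Sum.inr)
      (Set.finite_range _) rfl ?_ ?_
    · rintro (k | ⟨_, i, hi, rfl⟩)
      · exact ⟨.inl k, rfl⟩
      · exact ⟨.inr ⟨i, hi⟩, rfl⟩
    · rintro _ ⟨i, rfl⟩
      have := isOpenMap_inr (X := K') (Y := I) {i} (isOpen_discrete _)
      rwa [Set.image_singleton] at this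
    · rintro (k | i) (k' | i') hkk
      · exact .inl (congrArg Sum.inl (Sum.inl_injective hkk))
      · exact absurd hkk Sum.inl_ne_inr
      · exact absurd hkk Sum.inr_ne_inl
      · exact .inr ⟨⟨i, rfl⟩, ⟨i', rfl⟩⟩
  have hbc : IsSkeletalMap (F.map (b ≫ c)) := by
    rw [coe_map_comp]
    exact (hF.isSkeletalMap_of_irreducible c hc).comp hb
  -- The section `σ` of `a ≫ q` supplies a point here without `a` being surjective.
  have hne : (F.map (a ≫ q) ⁻¹' V).Nonempty := by
    refine ⟨F.map σ (F.map q x₀), ?_⟩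
    rw [Set.mem_preimage, map_map_apply, hσ, F.map_id]
    exact hxV
  refine (hbc.interior_closure_image (hV.preimage (hom_continuous _)) hne).mono
    (interior_mono (closure_mono ?_))
  rintro _ ⟨t, ht, rfl⟩
  refine ⟨F.map a t, hVU ?_, ?_⟩
  · rwa [Set.mem_preimage, map_map_apply]
  · rw [map_map_apply, hcomm]

theorem IsOneMec.isSkeletalFunctor {F : CompHaus.{u} ⥤ CompHaus.{u}} (hF : IsOneMec F)
    (h2 : ∀ Z : CompHaus.{u}, IsZeroDimensional Z → IsSkeletalMap (F.map (twoMap Z))) :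
    IsSkeletalFunctor F := by
  intro X Y f hfo hfs
  obtain ⟨X', p, hX', hp⟩ := exists_irreducible_cover X
  have hsk : IsSkeletalMap (F.map (p ≫ f)) := by
    refine hF.isSkeletalMap_of_interior_image h2 _ (hfs.comp hp.1) fun O hO hne => ?_
    obtain ⟨V, hV, hVne, hVO⟩ := hp.exists_preimage_subset (hom_isClosedMap p) hO hne
    refine (hVne.image f).mono (interior_maximal ?_ (hfo V hV))
    rintro _ ⟨x, hx, rfl⟩
    obtain ⟨x', rfl⟩ := hp.1 x
    exact ⟨x', hVO hx, rfl⟩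
  rw [coe_map_comp] at hsk
  exact hsk.of_comp (hom_continuous _) (hom_continuous _) (hF.epimorphic p hp.1)

theorem twoMap_isOpenMap (Z : CompHaus.{u}) : IsOpenMap (twoMap Z) :=
  IsOpenMap.sumMap (X := Z) (Y := Z) IsOpenMap.id (fun _ _ => isOpen_discrete _)

theorem twoMap_surjective (Z : CompHaus.{u}) : Function.Surjective (twoMap Z) := by
  rintro (z | k)
  · exact ⟨.inl z, rfl⟩
  · exact ⟨.inr 0, congrArg Sum.inr (Subsingleton.elim _ _)⟩

/-! ### Weight -/

theorem weight_le_aleph0_iff (X : Type u) [TopologicalSpace X] :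
    weight X ≤ Cardinal.aleph0 ↔ SecondCountableTopology X := by
  constructor
  · intro h
    have hmem := csInf_mem (s := {c | ∃ B : Set (Set X),
      TopologicalSpace.IsTopologicalBasis B ∧ Cardinal.mk B = c})
      ⟨_, _, TopologicalSpace.isTopologicalBasis_opens, rfl⟩
    obtain ⟨B, hB, hBc⟩ := hmem
    refine hB.secondCountableTopology ?_
    rw [← Cardinal.le_aleph0_iff_set_countable, hBc]
    exact h
  · intro h
    obtain ⟨B, hBc, -, hB⟩ := TopologicalSpace.exists_countable_basis X
    have hle : weight X ≤ Cardinal.mk B := csInf_le' ⟨B, hB, rfl⟩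
    exact hle.trans (Cardinal.le_aleph0_iff_set_countable.2 hBc)

/-! ### Quotients by families of clopen sets -/

/-- The sum of a map of compacta and the identity of a finite discrete space. -/
def addMap {X Y : CompHaus.{u}} (k : ℕ) (f : X ⟶ Y) : addFin X k ⟶ addFin Y k :=
  homMk (X := addFin X k) (Y := addFin Y k) (Sum.map f id)
    ((hom_continuous f).sumMap continuous_id)

theorem addMap_comp {X Y Z : CompHaus.{u}} (k : ℕ) (f : X ⟶ Y) (g : Y ⟶ Z) :
    addMap k f ≫ addMap k g = addMap k (f ≫ g) := by
  ext x
  rcases x with x | i <;> rfl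

theorem addMap_twoMap {X Y : CompHaus.{u}} (f : X ⟶ Y) :
    addMap 2 f ≫ twoMap Y = twoMap X ≫ addMap 1 f := by
  ext x
  rcases x with x | i <;> rfl

theorem addMap_surjective {X Y : CompHaus.{u}} (k : ℕ) {f : X ⟶ Y} (hf : Function.Surjective f) :
    Function.Surjective (addMap k f) := by
  rintro (y | i)
  · obtain ⟨x, rfl⟩ := hf y
    exact ⟨.inl x, rfl⟩
  · exact ⟨.inr i, rfl⟩

theorem addMap_jointly_injective {J : Type*} [Nonempty J] {X : CompHaus.{u}}
    {P : J → CompHaus.{u}} (k : ℕ) (p : ∀ j, X ⟶ P j)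
    (hp : ∀ x x', (∀ j, p j x = p j x') → x = x') (x x' : addFin X k)
    (h : ∀ j, addMap k (p j) x = addMap k (p j) x') : x = x' := by
  rcases x with x | i <;> rcases x' with x' | i'
  · exact congrArg Sum.inl (hp x x' fun j => Sum.inl_injective (h j))
  · exact absurd (h (Classical.arbitrary J)) Sum.inl_ne_inr
  · exact absurd (h (Classical.arbitrary J)) Sum.inr_ne_inl
  · exact congrArg Sum.inr (Sum.inr_injective (h (Classical.arbitrary J)))

section ClopenQuotient

variable (Z : CompHaus.{u})

open scoped Classical in
/-- The map to a Cantor cube given by the characteristic functions of a family of clopen sets. -/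
noncomputable def clopenMap (S : Set (TopologicalSpace.Clopens Z)) :
    Z ⟶ CompHaus.of (S → Bool) :=
  homMk (Y := CompHaus.of (S → Bool)) (fun z c => decide (z ∈ c.1))
    (continuous_pi fun c => by
      refine (continuous_bool_rng true).2 ?_
      convert c.1.isClopen using 1
      ext z
      simp)

theorem clopenMap_eq_iff (S : Set (TopologicalSpace.Clopens Z)) (z z' : Z) :
    clopenMap Z S z = clopenMap Z S z' ↔ ∀ c ∈ S, (z ∈ c ↔ z' ∈ c) := by
  refine funext_iff.trans ⟨fun h c hc => ?_, fun h c => ?_⟩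
  · exact decide_eq_decide.1 (h ⟨c, hc⟩)
  · exact decide_eq_decide.2 (h c c.2)

theorem isClosed_range_clopenMap (S : Set (TopologicalSpace.Clopens Z)) :
    IsClosed (Set.range (clopenMap Z S)) :=
  (isCompact_range (hom_continuous _)).isClosed

/-- The quotient of a compactum by a family of clopen sets. -/
noncomputable def clopenQuotient (S : Set (TopologicalSpace.Clopens Z)) : CompHaus.{u} :=
  closedSub (Set.range (clopenMap Z S)) (isClosed_range_clopenMap Z S)

/-- The projection to the quotient by a family of clopen sets. -/
noncomputable def clopenProj (S : Set (TopologicalSpace.Clopens Z)) : Z ⟶ clopenQuotient Z S :=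
  homMk (Y := clopenQuotient Z S)
    (fun z => (⟨clopenMap Z S z, z, rfl⟩ : Set.range (clopenMap Z S)))
    ((hom_continuous _).subtype_mk _)

theorem clopenProj_surjective (S : Set (TopologicalSpace.Clopens Z)) :
    Function.Surjective (clopenProj Z S) := by
  rintro ⟨_, z, rfl⟩
  exact ⟨z, rfl⟩

theorem clopenProj_eq_iff (S : Set (TopologicalSpace.Clopens Z)) (z z' : Z) :
    clopenProj Z S z = clopenProj Z S z' ↔ ∀ c ∈ S, (z ∈ c ↔ z' ∈ c) :=
  Subtype.ext_iff.trans (clopenMap_eq_iff Z S z z')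

theorem clopenQuotient_isZeroDimensional (S : Set (TopologicalSpace.Clopens Z)) :
    IsZeroDimensional (clopenQuotient Z S) := by
  have : TotallyDisconnectedSpace (CompHaus.of (S → Bool)) :=
    inferInstanceAs (TotallyDisconnectedSpace (S → Bool))
  exact isZeroDimensional_of_totallyDisconnected
    (closedSub (Set.range (clopenMap Z S)) (isClosed_range_clopenMap Z S))

theorem clopenQuotient_secondCountable {S : Set (TopologicalSpace.Clopens Z)}
    (hS : S.Countable) : SecondCountableTopology (clopenQuotient Z S) := by
  have : Countable S := hS
  have : SecondCountableTopology (CompHaus.of (S → Bool)) :=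
    inferInstanceAs (SecondCountableTopology (S → Bool))
  exact inferInstanceAs (SecondCountableTopology (Set.range (clopenMap Z S)))

variable {Z} in
/-- The projection between the quotients by nested families of clopen sets. -/
noncomputable def clopenTrans {S S' : Set (TopologicalSpace.Clopens Z)} (h : S ⊆ S') :
    clopenQuotient Z S' ⟶ clopenQuotient Z S :=
  descHom (clopenProj Z S') (clopenProj_surjective Z S') (clopenProj Z S) fun z z' hz => by
    rw [clopenProj_eq_iff] at hz ⊢
    exact fun c hc => hz c (h hc)

variable {Z}

theorem clopenProj_trans {S S' : Set (TopologicalSpace.Clopens Z)} (h : S ⊆ S') :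
    clopenProj Z S' ≫ clopenTrans h = clopenProj Z S := by
  ext z
  rw [ConcreteCategory.comp_apply, clopenTrans, descHom_apply]

theorem clopenTrans_trans {S S' S'' : Set (TopologicalSpace.Clopens Z)} (h : S ⊆ S')
    (h' : S' ⊆ S'') : clopenTrans h' ≫ clopenTrans h = clopenTrans (h.trans h') := by
  ext y
  obtain ⟨z, rfl⟩ := clopenProj_surjective Z S'' y
  have e (f g : clopenQuotient Z S'' ⟶ clopenQuotient Z S)
      (hfg : clopenProj Z S'' ≫ f = clopenProj Z S'' ≫ g) :
      f (clopenProj Z S'' z) = g (clopenProj Z S'' z) :=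
    congrArg (fun k : Z ⟶ clopenQuotient Z S => k z) hfg
  apply e
  rw [← Category.assoc, clopenProj_trans, clopenProj_trans, clopenProj_trans]

theorem clopenTrans_surjective {S S' : Set (TopologicalSpace.Clopens Z)} (h : S ⊆ S') :
    Function.Surjective (clopenTrans h) := by
  intro y
  obtain ⟨z, rfl⟩ := clopenProj_surjective Z S y
  exact ⟨clopenProj Z S' z, descHom_apply _ _ _ _ z⟩

theorem exists_clopen_separating [TotallyDisconnectedSpace Z] {z z' : Z} (h : z ≠ z') :
    ∃ c : TopologicalSpace.Clopens Z, z ∈ c ∧ z' ∉ c := by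
  have : T2Space Z := Z.is_hausdorff
  have : CompactSpace Z := Z.is_compact
  obtain ⟨V, hV, hzV, hVU⟩ := compact_exists_isClopen_in_isOpen
    (isOpen_compl_singleton (x := z')) h
  exact ⟨⟨V, hV⟩, hzV, fun h => hVU h rfl⟩

variable {F : CompHaus.{u} ⥤ CompHaus.{u}}

/-- Countable families are directed under union, and singletons already separate points. -/
theorem IsContinuousFunctor.exists_countable_clopenQuotient (hF : IsContinuousFunctor F)
    [TotallyDisconnectedSpace Z] (k : ℕ) {U : Set (F.obj (addFin Z k))} (hU : IsOpen U)
    {x : F.obj (addFin Z k)} (hx : x ∈ U) :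
    ∃ (S : Set (TopologicalSpace.Clopens Z)) (V : Set (F.obj (addFin (clopenQuotient Z S) k))),
      S.Countable ∧ IsOpen V ∧ F.map (addMap k (clopenProj Z S)) x ∈ V ∧
        F.map (addMap k (clopenProj Z S)) ⁻¹' V ⊆ U := by
  let J := {S : Set (TopologicalSpace.Clopens Z) // S.Countable}
  have : Nonempty J := ⟨⟨∅, Set.countable_empty⟩⟩
  have : IsDirectedOrder J := ⟨fun S S' => ⟨⟨S.1 ∪ S'.1, S.2.union S'.2⟩,
    Set.subset_union_left, Set.subset_union_right⟩⟩
  obtain ⟨S, V, hV, hxV, hVU⟩ := hF.exists_preimage_subset (J := J)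
    (fun S => addMap k (clopenProj Z S.1))
    (fun S => addMap_surjective k (clopenProj_surjective Z _))
    (fun S S' (h : S.1 ⊆ S'.1) x x' hx => by
      rw [← clopenProj_trans h, ← addMap_comp, ConcreteCategory.comp_apply,
        ConcreteCategory.comp_apply, hx])
    (addMap_jointly_injective k _ fun z z' h => by
      by_contra hne
      obtain ⟨c, hc, hc'⟩ := exists_clopen_separating hne
      exact hc' (((clopenProj_eq_iff Z _ z z').1
        (h ⟨{c}, Set.countable_singleton c⟩) c rfl).1 hc)) hU hx
  exact ⟨S.1, V, S.2, hV, hxV, hVU⟩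

theorem IsContinuousFunctor.exists_clopenQuotient_chain (hF : IsContinuousFunctor F)
    {S : ℕ → Set (TopologicalSpace.Clopens Z)} (hS : Monotone S) (k : ℕ)
    {U : Set (F.obj (addFin (clopenQuotient Z (⋃ n, S n)) k))} (hU : IsOpen U)
    {x : F.obj (addFin (clopenQuotient Z (⋃ n, S n)) k)} (hx : x ∈ U) :
    ∃ (n : ℕ) (V : Set (F.obj (addFin (clopenQuotient Z (S n)) k))), IsOpen V ∧
      F.map (addMap k (clopenTrans (Set.subset_iUnion S n))) x ∈ V ∧
        F.map (addMap k (clopenTrans (Set.subset_iUnion S n))) ⁻¹' V ⊆ U := by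
  obtain ⟨n, V, hV, hxV, hVU⟩ := hF.exists_preimage_subset (J := ULift.{u} ℕ)
    (fun n => addMap k (clopenTrans (Set.subset_iUnion S n.down)))
    (fun n => addMap_surjective k (clopenTrans_surjective _))
    (fun m n h x x' hx => by
      rw [← clopenTrans_trans (hS h) (Set.subset_iUnion S n.down), ← addMap_comp,
        ConcreteCategory.comp_apply, ConcreteCategory.comp_apply, hx])
    (addMap_jointly_injective k _ fun y y' h => by
      obtain ⟨z, rfl⟩ := clopenProj_surjective Z _ y
      obtain ⟨z', rfl⟩ := clopenProj_surjective Z _ y'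
      rw [clopenProj_eq_iff]
      intro c hc
      obtain ⟨n, hn⟩ := Set.mem_iUnion.1 hc
      have := h ⟨n⟩
      rw [← ConcreteCategory.comp_apply, ← ConcreteCategory.comp_apply, clopenProj_trans,
        clopenProj_eq_iff] at this
      exact this c hn) hU hx
  exact ⟨n.down, V, hV, hxV, hVU⟩

/-- An infinite totally disconnected compactum has an infinite quotient by countably many clopen
sets. -/
theorem exists_countable_infinite_clopenQuotient [TotallyDisconnectedSpace Z] [Infinite Z] :
    ∃ S : Set (TopologicalSpace.Clopens Z), S.Countable ∧
      ∀ S', S ⊆ S' → Infinite (clopenQuotient Z S') := by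
  let e := Infinite.natEmbedding Z
  have hsep : ∀ mn : {mn : ℕ × ℕ // mn.1 ≠ mn.2}, ∃ c : TopologicalSpace.Clopens Z,
      e mn.1.1 ∈ c ∧ e mn.1.2 ∉ c := fun mn =>
    exists_clopen_separating fun h => mn.2 (e.injective h)
  choose c hc hc' using hsep
  refine ⟨Set.range c, Set.countable_range c, fun S' hS' => ?_⟩
  refine Infinite.of_injective (fun n => clopenProj Z S' (e n)) fun m n h => ?_
  by_contra hne
  exact hc' ⟨(m, n), hne⟩
    (((clopenProj_eq_iff Z S' _ _).1 h _ (hS' ⟨⟨(m, n), hne⟩, rfl⟩)).1 (hc ⟨(m, n), hne⟩))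

/-- The quotient must be infinite because the weight bound covers only infinite compacta. -/
theorem IsWeightPreserving.secondCountable (hF : IsWeightPreserving F)
    {S : Set (TopologicalSpace.Clopens Z)} (hS : S.Countable) [Infinite (clopenQuotient Z S)]
    (k : ℕ) : SecondCountableTopology (F.obj (addFin (clopenQuotient Z S) k)) := by
  have := clopenQuotient_secondCountable Z hS
  have h1 : SecondCountableTopology (addFin (clopenQuotient Z S) k) :=
    inferInstanceAs (SecondCountableTopology (clopenQuotient Z S ⊕ Fin k))
  have h2 : Infinite (addFin (clopenQuotient Z S) k) :=
    inferInstanceAs (Infinite (clopenQuotient Z S ⊕ Fin k))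
  exact (weight_le_aleph0_iff _).1 ((hF _ h2).trans ((weight_le_aleph0_iff _).2 h1))

/-- One step of the closing-off argument: nowhere density of a set is witnessed, for the open sets
coming from a quotient by countably many clopen sets, in a larger such quotient. -/
theorem IsOneMec.exists_avoiding_clopenQuotient (hF : IsOneMec F) [TotallyDisconnectedSpace Z]
    {S : Set (TopologicalSpace.Clopens Z)} (hS : S.Countable)
    [SecondCountableTopology (F.obj (addFin (clopenQuotient Z S) 1))]
    {G : Set (F.obj (addFin Z 1))} (hG : IsNowhereDense G) :
    ∃ S' : Set (TopologicalSpace.Clopens Z), S ⊆ S' ∧ S'.Countable ∧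
      ∀ W : Set (F.obj (addFin (clopenQuotient Z S) 1)), IsOpen W → W.Nonempty →
        ∃ W' : Set (F.obj (addFin (clopenQuotient Z S') 1)), IsOpen W' ∧ W'.Nonempty ∧
          F.map (addMap 1 (clopenProj Z S')) ⁻¹' W' ⊆
            F.map (addMap 1 (clopenProj Z S)) ⁻¹' W ∩ Gᶜ := by
  obtain ⟨B, hBc, hB0, hB⟩ := TopologicalSpace.exists_countable_basis
    (F.obj (addFin (clopenQuotient Z S) 1))
  have hsurj := hF.epimorphic _ (addMap_surjective 1 (clopenProj_surjective Z S))
  have hstep : ∀ W : B, ∃ (T : Set (TopologicalSpace.Clopens Z))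
      (V : Set (F.obj (addFin (clopenQuotient Z T) 1))) (x : F.obj (addFin Z 1)),
      T.Countable ∧ IsOpen V ∧ F.map (addMap 1 (clopenProj Z T)) x ∈ V ∧
        F.map (addMap 1 (clopenProj Z T)) ⁻¹' V ⊆
          F.map (addMap 1 (clopenProj Z S)) ⁻¹' W.1 ∩ Gᶜ := by
    rintro ⟨W, hW⟩
    have hWo : IsOpen (F.map (addMap 1 (clopenProj Z S)) ⁻¹' W) :=
      (hB.isOpen hW).preimage (hom_continuous _)
    have hWne : (F.map (addMap 1 (clopenProj Z S)) ⁻¹' W).Nonempty :=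
      (Set.nonempty_iff_ne_empty.2 fun h => hB0 (h ▸ hW)).preimage hsurj
    obtain ⟨x, hxW, hxG⟩ : ∃ x ∈ F.map (addMap 1 (clopenProj Z S)) ⁻¹' W, x ∉ closure G := by
      by_contra hcon
      push Not at hcon
      obtain ⟨x, hx⟩ := hWne
      have : x ∈ interior (closure G) := interior_maximal hcon hWo hx
      rw [hG] at this
      exact this
    obtain ⟨T, V, hT, hV, hxV, hVU⟩ := hF.continuous.exists_countable_clopenQuotient 1
      (hWo.inter isClosed_closure.isOpen_compl) ⟨hxW, hxG⟩
    exact ⟨T, V, x, hT, hV, hxV,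
      hVU.trans (Set.inter_subset_inter_right _ (Set.compl_subset_compl.2 subset_closure))⟩
  -- One countable family per member of a countable base keeps the enlarged family countable.
  choose T V x hT hV hxV hVW using hstep
  have : Countable B := hBc
  refine ⟨S ∪ ⋃ W : B, T W, Set.subset_union_left, hS.union (Set.countable_iUnion hT),
    fun W hW hWne => ?_⟩
  obtain ⟨w, hw⟩ := hWne
  obtain ⟨W₀, hW₀, -, hW₀W⟩ := hB.exists_subset_of_mem_open hw hW
  have hsub : T ⟨W₀, hW₀⟩ ⊆ S ∪ ⋃ W : B, T W :=
    (Set.subset_iUnion T ⟨W₀, hW₀⟩).trans Set.subset_union_right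
  refine ⟨F.map (addMap 1 (clopenTrans hsub)) ⁻¹' V ⟨W₀, hW₀⟩,
    (hV _).preimage (hom_continuous _),
    ⟨F.map (addMap 1 (clopenProj Z _)) (x ⟨W₀, hW₀⟩), ?_⟩, fun y hy => ?_⟩
  · rw [Set.mem_preimage, map_map_apply, addMap_comp, clopenProj_trans]
    exact hxV _
  · rw [Set.mem_preimage, Set.mem_preimage, map_map_apply, addMap_comp, clopenProj_trans] at hy
    have := hVW ⟨W₀, hW₀⟩ hy
    exact ⟨hW₀W this.1, this.2⟩

end ClopenQuotient

/-- If the image of `U` were nowhere dense, iterating `IsOneMec.exists_avoiding_clopenQuotient`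
countably often would give a metrizable quotient where every nonempty open set contains one whose
preimage avoids that image. Skeletality there contradicts this. -/
theorem IsOneMecw.isSkeletalMap_twoMap {F : CompHaus.{u} ⥤ CompHaus.{u}} (hF : IsOneMecw F)
    (h2 : ∀ Z : CompHaus.{u}, IsZeroDimensional Z → TopologicalSpace.MetrizableSpace Z →
      IsSkeletalMap (F.map (twoMap Z)))
    (Z : CompHaus.{u}) (hZ : IsZeroDimensional Z) : IsSkeletalMap (F.map (twoMap Z)) := by
  have hTD := hZ.totallyDisconnected
  have hT2 : T2Space Z := Z.is_hausdorff
  rcases finite_or_infinite Z with hfin | hinf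
  · have := discreteTopology_of_finite Z
    exact h2 Z hZ inferInstance
  refine isSkeletalMap_of_interior_closure_image (fun U hU hne => ?_) (hom_continuous _)
  rw [Set.nonempty_iff_ne_empty]
  intro hG
  obtain ⟨x, hx⟩ := hne
  obtain ⟨S₁, V, hS₁, hV, hxV, hVU⟩ :=
    hF.continuous.exists_countable_clopenQuotient 2 hU hx
  obtain ⟨S₀, hS₀, hS₀inf⟩ := exists_countable_infinite_clopenQuotient (Z := Z)
  -- Containing `S₀` keeps each stage infinite, so `F` yields second countable spaces.
  let J := {S : Set (TopologicalSpace.Clopens Z) // S.Countable ∧ S₀ ⊆ S}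
  have hstep : ∀ S : J, ∃ S' : J, S.1 ⊆ S'.1 ∧
      ∀ W : Set (F.obj (addFin (clopenQuotient Z S.1) 1)), IsOpen W → W.Nonempty →
        ∃ W' : Set (F.obj (addFin (clopenQuotient Z S'.1) 1)), IsOpen W' ∧ W'.Nonempty ∧
          F.map (addMap 1 (clopenProj Z S'.1)) ⁻¹' W' ⊆
            F.map (addMap 1 (clopenProj Z S.1)) ⁻¹' W ∩ (F.map (twoMap Z) '' U)ᶜ := by
    rintro ⟨S, hS, hS₀S⟩
    have := hS₀inf S hS₀S
    have := hF.weightPreserving.secondCountable hS 1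
    obtain ⟨S', hSS', hS', h⟩ := hF.toIsOneMec.exists_avoiding_clopenQuotient hS hG
    exact ⟨⟨S', hS', hS₀S.trans hSS'⟩, hSS', h⟩
  choose next hsub hnext using hstep
  let S : ℕ → J := fun n => next^[n] ⟨S₀ ∪ S₁, hS₀.union hS₁, Set.subset_union_left⟩
  have hSsucc : ∀ n, S (n + 1) = next (S n) := fun n => Function.iterate_succ_apply' _ _ _
  let S' : ℕ → Set (TopologicalSpace.Clopens Z) := fun n => (S n).1
  have hmono : Monotone S' := monotone_nat_of_le_succ fun n => by
    change (S n).1 ⊆ (S (n + 1)).1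
    rw [hSsucc]
    exact hsub _
  have hcount : (⋃ n, S' n).Countable := Set.countable_iUnion fun n => (S n).2.1
  have hS₁sub : S₁ ⊆ ⋃ n, S' n :=
    Set.subset_union_right.trans (Set.subset_iUnion S' 0)
  have hsec := clopenQuotient_secondCountable Z hcount
  have hT2' : T2Space (clopenQuotient Z (⋃ n, S' n)) := (clopenQuotient Z _).is_hausdorff
  have hcpt : CompactSpace (clopenQuotient Z (⋃ n, S' n)) := (clopenQuotient Z _).is_compact
  have hsk := h2 (clopenQuotient Z (⋃ n, S' n)) (clopenQuotient_isZeroDimensional Z _)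
    inferInstance
  let proj := clopenProj Z (⋃ n, S' n)
  have hproj : ∀ k, Function.Surjective (F.map (addMap k proj)) := fun k =>
    hF.epimorphic _ (addMap_surjective k (clopenProj_surjective Z _))
  let U' : Set (F.obj (addFin (clopenQuotient Z (⋃ n, S' n)) 2)) :=
    F.map (addMap 2 (clopenTrans hS₁sub)) ⁻¹' V
  have hU' : IsOpen U' := hV.preimage (hom_continuous _)
  have hU'ne : U'.Nonempty := ⟨F.map (addMap 2 proj) x, by
    rw [Set.mem_preimage, map_map_apply, addMap_comp, clopenProj_trans]
    exact hxV⟩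
  obtain ⟨w, hw⟩ := hsk.interior_closure_image hU' hU'ne
  obtain ⟨n, W, hW, hwW, hWsub⟩ :=
    hF.continuous.exists_clopenQuotient_chain hmono 1 isOpen_interior hw
  obtain ⟨W', hW', hW'ne, hW'sub⟩ := hnext (S n) W hW ⟨_, hwW⟩
  have hsubn : (next (S n)).1 ⊆ ⋃ n, S' n := by
    rw [← hSsucc]
    exact Set.subset_iUnion S' (n + 1)
  have hW''ne : (F.map (addMap 1 (clopenTrans hsubn)) ⁻¹' W').Nonempty :=
    hW'ne.preimage (hF.epimorphic _ (addMap_surjective 1 (clopenTrans_surjective _)))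
  -- points of the quotient lift to `Z ⊕ 1`
  have hlift : ∀ y : F.obj (addFin Z 1),
      F.map (addMap 1 (clopenTrans hsubn)) (F.map (addMap 1 proj) y) ∈ W' →
        F.map (addMap 1 proj) y ∈ closure (F.map (twoMap _) '' U') ∧
          y ∉ F.map (twoMap Z) '' U := by
    intro y hy
    rw [map_map_apply, addMap_comp, clopenProj_trans] at hy
    have hy' := hW'sub hy
    refine ⟨interior_subset (hWsub ?_), hy'.2⟩
    rw [Set.mem_preimage, map_map_apply, addMap_comp, clopenProj_trans]
    exact hy'.1
  obtain ⟨w', hw'⟩ := hW''ne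
  obtain ⟨y, rfl⟩ := hproj 1 w'
  -- The image of `U'` is dense near this point, so some `u ∈ U'` lands over `W'`. A lift of `u`
  -- lies in `U`, yet its image should avoid the image of `U`.
  obtain ⟨_, hmem, u, huU', rfl⟩ := mem_closure_iff.1 (hlift y hw').1 _
    (hW'.preimage (hom_continuous (F.map (addMap 1 (clopenTrans hsubn))))) hw'
  obtain ⟨v, rfl⟩ := hproj 2 u
  have hcomm : F.map (twoMap _) (F.map (addMap 2 proj) v) =
      F.map (addMap 1 proj) (F.map (twoMap Z) v) := by
    rw [map_map_apply, map_map_apply, addMap_twoMap]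
  rw [Set.mem_preimage, hcomm] at hmem
  refine (hlift _ hmem).2 ⟨v, hVU ?_, rfl⟩
  have huV : F.map (addMap 2 (clopenTrans hS₁sub)) (F.map (addMap 2 proj) v) ∈ V := huU'
  rwa [map_map_apply, addMap_comp, clopenProj_trans] at huV

end CompFunctor

theorem theorem1p1 (F : CompHaus.{u} ⥤ CompHaus.{u}) :
    (CompFunctor.IsOneMec F →
      (CompFunctor.IsSkeletalFunctor F ↔
        ∀ Z : CompHaus.{u}, CompFunctor.IsZeroDimensional Z →
          CompFunctor.IsSkeletalMap (F.map (CompFunctor.twoMap Z)))) ∧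
    (CompFunctor.IsOneMecw F →
      (CompFunctor.IsSkeletalFunctor F ↔
        ∀ Z : CompHaus.{u}, CompFunctor.IsZeroDimensional Z → TopologicalSpace.MetrizableSpace Z →
          CompFunctor.IsSkeletalMap (F.map (CompFunctor.twoMap Z)))) := by
  refine ⟨fun hF => ⟨fun h Z _ => ?_, hF.isSkeletalFunctor⟩,
    fun hF => ⟨fun h Z _ _ => ?_, fun h => hF.toIsOneMec.isSkeletalFunctor
      (hF.isSkeletalMap_twoMap h)⟩⟩ <;>
  exact h _ (CompFunctor.twoMap_isOpenMap Z) (CompFunctor.twoMap_surjective Z)
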